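/- Let $k$ be an algebraically closed field and let $S$ be a local Noetherian normal commutative $k$-domain with maximal ideal $\mathfrak m$ such that $S/\mathfrak m = k$. Let $G$ be a finite subgroup of the group $\mathrm{Aut}_k(S)$ of $k$-algebra automorphisms of $S$ such that $|G|$ is invertible in $k$, and let $R = S^G$ be the invariant ring. Assume that $R \hookrightarrow S$ is unramified in codimension one: it is essentially of finite type and, for every prime $\mathfrak p$ of height one in $S$ with $\mathfrak q = \mathfrak p \cap R$, one has $\mathfrak q S_{\mathfrak p} = \mathfrak p S_{\mathfrak p}$ and the residue field extension $\kappa(\mathfrak q) \subseteq \kappa(\mathfrak p)$ is separable. Let $S*G = \bigoplus_{g \in G} S g$ be the skew group ring, with multiplication $(sg)(th) = s\,g(t)\cdot gh$. Let $\mathrm{Ref}(R)$ be the category of finitely generated reflexive $R$-modules with $R$-linear maps, and let $\mathrm{Ref}(S*G)$ be the category of finitely generated left $S*G$-modules that are reflexive as $S$-modules, with $S*G$-linear maps. Write $(-)^* = \mathrm{Hom}_S(-,S)$, where for an $S*G$-module $M$ the group $G$ acts on $M^*$ by $g(\varphi) = g \circ \varphi \circ g^{-1}$, and let $G$ act on $S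 \otimes_R N$ by $g(s \otimes n) = g(s) \otimes n$. Then $M \mapsto M^G$, $\varphi \mapsto \varphi|_{M^G}$, defines a functor $\mathcal G : \mathrm{Ref}(S*G) \to \mathrm{Ref}(R)$, and $N \mapsto (S \otimes_R N)^{**}$, $\psi \mapsto (\mathrm{id}_S \otimes \psi)^{**}$, defines a functor $\mathcal G' : \mathrm{Ref}(R) \to \mathrm{Ref}(S*G)$, and these two functors are mutually quasi-inverse; they give an equivalence of categories $\mathrm{Ref}(S*G) \cong \mathrm{Ref}(R)$. -/

import Mathlib

open CategoryTheory

universe u v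

noncomputable section

namespace AuslanderRef

section Unramified

/-- A local homomorphism `(A, 𝔪, K) → (B, 𝔫, L)` of local rings is unramified if `𝔪B = 𝔫` and
`L/K` is a separable field extension. (The finiteness condition that goes with this notion is
part of `UnramifiedInCodimOne`.) -/
def IsUnramifiedLocalHom {A B : Type*} [CommRing A] [IsLocalRing A] [CommRing B] [IsLocalRing B]
    (f : A →+* B) [IsLocalHom f] : Prop :=
  (IsLocalRing.maximalIdeal A).map f = IsLocalRing.maximalIdeal B ∧
    @Algebra.IsSeparable (IsLocalRing.ResidueField A) (IsLocalRing.ResidueField B) _ _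
      (IsLocalRing.ResidueField.map f).toAlgebra

/-- `A → B` is essentially of finite type, and `A_{𝔭 ∩ A} → B_𝔭` is unramified for every prime
`𝔭` of height one in `B`. -/
def UnramifiedInCodimOne (A B : Type*) [CommRing A] [CommRing B] [Algebra A B] : Prop :=
  Algebra.EssFiniteType A B ∧
    ∀ (p : Ideal B) [p.IsPrime], p.height = 1 →
      IsUnramifiedLocalHom (Localization.localRingHom (p.comap (algebraMap A B)) p
        (algebraMap A B) rfl)

end Unramified

section Skew

variable (S : Type u) [CommRing S] (G : Type u) [Group G] [MulSemiringAction G S]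

/-- The embedding `S → S * G`, `s ↦ s · 1_G`. The skew group ring `S * G`, with multiplication
`(s g) (t h) = s g(t) · gh`, is `SkewMonoidAlgebra S G`; the element `s g` is `single g s`. -/
def inclSkew : S →+* SkewMonoidAlgebra S G where
  toFun s := SkewMonoidAlgebra.single 1 s
  map_one' := rfl
  map_mul' s t := by simp [SkewMonoidAlgebra.single_mul_single]
  map_zero' := by simp
  map_add' s t := by simp [SkewMonoidAlgebra.single_add]

variable {S G}

/-- An `S * G`-module is an `S`-module through `inclSkew`. -/
instance instModuleBase (M : ModuleCat.{u} (SkewMonoidAlgebra S G)) : Module S M :=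
  Module.compHom M (inclSkew S G)

theorem smul_def (M : ModuleCat.{u} (SkewMonoidAlgebra S G)) (s : S) (m : M) :
    s • m = SkewMonoidAlgebra.single (1 : G) s • m := rfl

/-- The `S`-linear map underlying a homomorphism of `S * G`-modules. -/
def homBase {M N : ModuleCat.{u} (SkewMonoidAlgebra S G)} (f : M ⟶ N) : M →ₗ[S] N where
  toFun := f.hom
  map_add' := f.hom.map_add
  map_smul' s m := f.hom.map_smul (SkewMonoidAlgebra.single (1 : G) s) m

/-- The action of `G` on an `S * G`-module `M`. -/
def act (M : ModuleCat.{u} (SkewMonoidAlgebra S G)) : G →* AddMonoid.End M where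
  toFun g := DistribSMul.toAddMonoidHom M (SkewMonoidAlgebra.single g (1 : S))
  map_one' := by
    ext m
    exact one_smul (SkewMonoidAlgebra S G) m
  map_mul' g h := by
    ext m
    change SkewMonoidAlgebra.single (g * h) (1 : S) • m =
      SkewMonoidAlgebra.single g (1 : S) • SkewMonoidAlgebra.single h (1 : S) • m
    rw [← mul_smul]
    simp [SkewMonoidAlgebra.single_mul_single]

theorem act_apply (M : ModuleCat.{u} (SkewMonoidAlgebra S G)) (g : G) (m : M) :
    act M g m = SkewMonoidAlgebra.single g (1 : S) • m := rfl

theorem act_smul (M : ModuleCat.{u} (SkewMonoidAlgebra S G)) (g : G) (s : S) (m : M) :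
    act M g (s • m) = (g • s) • act M g m := by
  rw [act_apply, act_apply, smul_def, smul_def, ← mul_smul, ← mul_smul]
  simp [SkewMonoidAlgebra.single_mul_single]

theorem map_act {M N : ModuleCat.{u} (SkewMonoidAlgebra S G)} (f : M ⟶ N) (g : G) (m : M) :
    homBase f (act M g m) = act N g (homBase f m) :=
  f.hom.map_smul _ _

/-- An `S`-module with a compatible action of `G`, i.e. `g(sm) = g(s)g(m)`, as an `S * G`-module:
`(s g) m = s g(m)`. -/
abbrev skewModule (M : Type u) [AddCommGroup M] [Module S M] (ρ : G →* AddMonoid.End M)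
    (h : ∀ (g : G) (s : S) (m : M), ρ g (s • m) = (g • s) • ρ g m) :
    Module (SkewMonoidAlgebra S G) M :=
  Module.compHom M (SkewMonoidAlgebra.liftNCRingHom (Module.toAddMonoidEnd S M) ρ
    (fun {s g} => by
      ext m
      exact (h g s m).symm))

/-- The `S * G`-module given by an `S`-module with a compatible action of `G`. -/
def ofAction (M : Type u) [AddCommGroup M] [Module S M] (ρ : G →* AddMonoid.End M)
    (h : ∀ (g : G) (s : S) (m : M), ρ g (s • m) = (g • s) • ρ g m) :
    ModuleCat.{u} (SkewMonoidAlgebra S G) :=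
  @ModuleCat.of (SkewMonoidAlgebra S G) _ M _ (skewModule M ρ h)

theorem single_smul_ofAction (M : Type u) [AddCommGroup M] [Module S M]
    (ρ : G →* AddMonoid.End M)
    (h : ∀ (g : G) (s : S) (m : M), ρ g (s • m) = (g • s) • ρ g m) (g : G) (s : S) (m : M) :
    letI := skewModule M ρ h
    SkewMonoidAlgebra.single g s • m = s • ρ g m := by
  change (SkewMonoidAlgebra.liftNC _ _ (SkewMonoidAlgebra.single g s) : AddMonoid.End M) m = _
  rw [SkewMonoidAlgebra.liftNC_single]
  rfl

/-- An `S`-linear map that commutes with the actions of `G` is `S * G`-linear. -/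
def ofActionHom {M N : Type u} [AddCommGroup M] [Module S M] [AddCommGroup N] [Module S N]
    {ρ : G →* AddMonoid.End M} {h : ∀ (g : G) (s : S) (m : M), ρ g (s • m) = (g • s) • ρ g m}
    {σ : G →* AddMonoid.End N} {h' : ∀ (g : G) (s : S) (n : N), σ g (s • n) = (g • s) • σ g n}
    (f : M →ₗ[S] N) (hf : ∀ g m, f (ρ g m) = σ g (f m)) :
    ofAction M ρ h ⟶ ofAction N σ h' :=
  letI := skewModule M ρ h
  letI := skewModule N σ h'
  ModuleCat.ofHom (X := M) (Y := N)
    { toFun := f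
      map_add' := f.map_add
      map_smul' := fun a m => by
        induction a using SkewMonoidAlgebra.induction_on with
        | zero => simp
        | single g s =>
          have h₁ := single_smul_ofAction M ρ h g s m
          have h₂ := single_smul_ofAction N σ h' g s (f m)
          refine (congrArg f h₁).trans (Eq.trans ?_ h₂.symm)
          rw [f.map_smul, hf]
        | add a b ha hb =>
          rw [add_smul, map_add, ha, hb]
          simp [add_smul] }

end Skew

section Dual

variable {S : Type u} [CommRing S] {G : Type u} [Group G] [MulSemiringAction G S]

/-- The action of `G` on `Hom_S(M, S)`: `g(φ) = g ∘ φ ∘ g⁻¹`. -/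
def dualAct (M : ModuleCat.{u} (SkewMonoidAlgebra S G)) :
    G →* AddMonoid.End (Module.Dual S M) where
  toFun g :=
    { toFun := fun φ =>
        { toFun := fun m => g • φ (act M g⁻¹ m)
          map_add' := fun m n => by rw [map_add, map_add, smul_add]
          map_smul' := fun s m => by
            rw [act_smul, map_smul]
            simp [smul_mul'] }
      map_zero' := by ext m; exact smul_zero g
      map_add' := fun φ ψ => by ext m; exact smul_add g _ _ }
  map_one' := by
    ext φ m
    change (1 : G) • φ (act M 1⁻¹ m) = φ m
    rw [inv_one, map_one, one_smul]
    rfl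
  map_mul' g h := by
    ext φ m
    change (g * h) • φ (act M (g * h)⁻¹ m) = g • h • φ (act M h⁻¹ (act M g⁻¹ m))
    rw [mul_inv_rev, map_mul, mul_smul]
    rfl

theorem dualAct_apply (M : ModuleCat.{u} (SkewMonoidAlgebra S G)) (g : G)
    (φ : Module.Dual S M) (m : M) :
    dualAct M g φ m = g • φ (act M g⁻¹ m) := rfl

theorem dualAct_smul (M : ModuleCat.{u} (SkewMonoidAlgebra S G)) (g : G) (s : S)
    (φ : Module.Dual S M) :
    dualAct M g (s • φ) = (g • s) • dualAct M g φ := by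
  ext m
  exact smul_mul' g s (φ (act M g⁻¹ m))

variable (S G)

/-- The contravariant functor `M ↦ M^* = Hom_S(M, S)` on `S * G`-modules. -/
def dualFunctor : (ModuleCat.{u} (SkewMonoidAlgebra S G))ᵒᵖ ⥤
    ModuleCat.{u} (SkewMonoidAlgebra S G) where
  obj M := ofAction (Module.Dual S M.unop) (dualAct M.unop) (dualAct_smul M.unop)
  map f := ofActionHom (LinearMap.dualMap (homBase f.unop)) (fun g φ => by
    ext n
    simp only [LinearMap.dualMap_apply, dualAct_apply, map_act])
  map_id _ := rfl
  map_comp _ _ := rfl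

end Dual

section Functors

variable (k : Type v) [CommRing k] (S : Type u) [CommRing S] [Algebra k S]
  (G : Type u) [Group G] [MulSemiringAction G S] [SMulCommClass G k S]

/-- The invariant ring `R = S^G`. -/
abbrev InvRing : Type u := FixedPoints.subalgebra k S G

/-- The `R`-submodule `M^G` of an `S * G`-module `M`. -/
def invariants (M : ModuleCat.{u} (SkewMonoidAlgebra S G)) :
    Submodule (InvRing k S G) M where
  carrier := {m | ∀ g : G, act M g m = m}
  add_mem' {m n} hm hn g := by rw [map_add, hm g, hn g]
  zero_mem' g := (act M g).map_zero
  smul_mem' r m hm g := by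
    change act M g ((r : S) • m) = (r : S) • m
    rw [act_smul, r.2 g, hm g]

/-- The functor `M ↦ M^G` from `S * G`-modules to `R`-modules; a homomorphism is restricted to
the invariants. -/
def invFunctor : ModuleCat.{u} (SkewMonoidAlgebra S G) ⥤ ModuleCat.{u} (InvRing k S G) where
  obj M := ModuleCat.of (InvRing k S G) (invariants k S G M)
  map {M N} f := ModuleCat.ofHom
    (((homBase f).restrictScalars (InvRing k S G)).restrict
      (p := invariants k S G M) (q := invariants k S G N)
      (fun m hm g => (map_act f g m).symm.trans (congrArg (homBase f) (hm g))))
  map_id _ := rfl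
  map_comp _ _ := rfl

/-- The action of `g ∈ G` on `S` as an `R`-linear map. -/
def actS (g : G) : S →ₗ[InvRing k S G] S where
  toFun s := g • s
  map_add' := smul_add g
  map_smul' r s := by
    change g • ((r : S) * s) = (r : S) * g • s
    rw [smul_mul', r.2 g]

/-- The action of `G` on `S ⊗_R N`: `g(s ⊗ n) = g(s) ⊗ n`. -/
def tensorAct (N : ModuleCat.{u} (InvRing k S G)) :
    G →* AddMonoid.End (TensorProduct (InvRing k S G) S N) where
  toFun g := (LinearMap.rTensor N (actS k S G g)).toAddMonoidHom
  map_one' := by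
    have : actS k S G 1 = LinearMap.id := by ext s; exact one_smul G s
    rw [this, LinearMap.rTensor_id]
    rfl
  map_mul' g h := by
    have : actS k S G (g * h) = actS k S G g ∘ₗ actS k S G h := by ext s; exact mul_smul g h s
    rw [this, LinearMap.rTensor_comp]
    rfl

theorem tensorAct_tmul (N : ModuleCat.{u} (InvRing k S G)) (g : G) (s : S) (n : N) :
    tensorAct k S G N g (TensorProduct.tmul _ s n) = TensorProduct.tmul _ (g • s) n := rfl

theorem tensorAct_smul (N : ModuleCat.{u} (InvRing k S G)) (g : G) (s : S)
    (x : TensorProduct (InvRing k S G) S N) :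
    tensorAct k S G N g (s • x) = (g • s) • tensorAct k S G N g x := by
  induction x with
  | zero => simp
  | tmul t n =>
    rw [TensorProduct.smul_tmul', tensorAct_tmul, tensorAct_tmul, TensorProduct.smul_tmul',
      smul_eq_mul, smul_eq_mul, smul_mul']
  | add x y hx hy => rw [smul_add, map_add, hx, hy, map_add, smul_add]

/-- The functor `N ↦ S ⊗_R N`, `ψ ↦ id_S ⊗ ψ` from `R`-modules to `S * G`-modules. -/
def tensorFunctor : ModuleCat.{u} (InvRing k S G) ⥤ ModuleCat.{u} (SkewMonoidAlgebra S G) where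
  obj N := ofAction (TensorProduct (InvRing k S G) S N) (tensorAct k S G N)
    (tensorAct_smul k S G N)
  map {N₁ N₂} ψ := ofActionHom (TensorProduct.AlgebraTensorModule.lTensor S S ψ.hom)
    (fun g x => by
      induction x with
      | zero => simp
      | tmul t n => rfl
      | add x y hx hy => rw [map_add, map_add, hx, hy, map_add, map_add])
  map_id N := by
    ext x
    exact DFunLike.congr_fun (TensorProduct.AlgebraTensorModule.lTensor_id
      (R := InvRing k S G) (A := S) (M := S) (N := N)) x
  map_comp f g := by
    ext x
    exact DFunLike.congr_fun (TensorProduct.AlgebraTensorModule.lTensor_comp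
      (R := InvRing k S G) (A := S) (M := S) g.hom f.hom) x

/-- The functor `N ↦ (S ⊗_R N)^{**}`, `ψ ↦ (id_S ⊗ ψ)^{**}`, with `(-)^* = Hom_S(-, S)`. -/
def reflTensorFunctor :
    ModuleCat.{u} (InvRing k S G) ⥤ ModuleCat.{u} (SkewMonoidAlgebra S G) :=
  tensorFunctor k S G ⋙ (dualFunctor S G).rightOp ⋙ dualFunctor S G

end Functors

/-- `Ref(R)`: the finitely generated reflexive `R`-modules. -/
def IsRef (R : Type u) [CommRing R] : ObjectProperty (ModuleCat.{u} R) :=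
  fun N => Module.Finite R N ∧ Module.IsReflexive R N

/-- `Ref(S * G)`: the finitely generated `S * G`-modules that are reflexive as `S`-modules. -/
def IsRefSkew (S : Type u) [CommRing S] (G : Type u) [Group G] [MulSemiringAction G S] :
    ObjectProperty (ModuleCat.{u} (SkewMonoidAlgebra S G)) :=
  fun M => Module.Finite (SkewMonoidAlgebra S G) M ∧ Module.IsReflexive S M

end AuslanderRef

end

/-!
Write `R = S^G`. The equivalence comes down to the fact that the multiplication map
`μ : S ⊗_R M^G → M` is an isomorphism outside codimension two, for every `S * G`-module `M`. Let
`D ⊆ S` be the ideal of all `∑ uᵢ tᵢ`, where `∑ uᵢ ⊗ tᵢ` satisfies `∑ uᵢ g(tᵢ) = 0` for all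
`g ≠ 1`. The map `m ↦ ∑ uᵢ ⊗ Tr(tᵢ m)` is an inverse of `μ` up to multiplication by `∑ uᵢ tᵢ`, so
`D` kills the kernel and the cokernel of `μ`. A prime with trivial inertia does not contain `D`:
for each `h ≠ 1` choose `a` such that `h(a) - a` is outside the prime, and take the product of all
`h(a) ⊗ 1 - 1 ⊗ a`. Inertia is trivial at the unramified primes, hence `D` has height at least
two, and as `S` is normal, `Hom_S(μ, S)` is an isomorphism.

Consequently `(M^*)^G → (M^G)^*` is an isomorphism, since it factors through
`((S ⊗_R M^G)^*)^G ≅ (M^G)^*`. Taking invariants thus commutes with biduals, so that `M^G` is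
reflexive if `M` is, and `N → ((S ⊗_R N)^{**})^G` is `N → N^{**}`. In the other direction,
`M ≅ M^{**} ≅ (S ⊗_R M^G)^{**}`.

Finiteness of `M^G` over `R` holds because `S` is integral and essentially of finite type, hence
finite, over `R`, and so `R` is Noetherian by the Eakin–Nagata theorem.
-/

noncomputable section

namespace AuslanderRef

/-! ### Extension over codimension two -/

section Hartogs

variable {S : Type*} [CommRing S] [IsDomain S]

theorem two_le_height {D : Ideal S} (hD : D ≠ ⊥)
    (h : ∀ p : Ideal S, p.IsPrime → p.height = 1 → ¬ D ≤ p) : 2 ≤ D.height := by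
  by_contra! hlt
  obtain ⟨n, hn⟩ := ENat.ne_top_iff_exists.1 hlt.ne_top
  obtain ⟨p, hp, hDp, hpn⟩ := Ideal.exists_isPrime_height_eq hn.symm
  rw [← hn] at hlt
  have hn2 : n < 2 := by exact_mod_cast hlt
  interval_cases n
  · exact hD (Ideal.height_eq_zero_iff_eq_bot.1 (by exact_mod_cast hn.symm))
  · exact h p hp (by exact_mod_cast hpn) hDp

theorem ne_bot_of_two_le_height {D : Ideal S} (hD : 2 ≤ D.height) : D ≠ ⊥ := by
  rintro rfl
  simp at hD

theorem dualMap_injective_of_smul_mem_range {A B : Type*} [AddCommGroup A] [Module S A]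
    [AddCommGroup B] [Module S B] {d : S} (hd : d ≠ 0) (i : A →ₗ[S] B)
    (hrange : ∀ b, d • b ∈ LinearMap.range i) : Function.Injective i.dualMap := by
  rw [injective_iff_map_eq_zero]
  intro φ hφ
  ext b
  obtain ⟨a, ha⟩ := hrange b
  have hdφ : d * φ b = 0 := by
    rw [← smul_eq_mul, ← map_smul, ← ha]
    exact LinearMap.congr_fun hφ a
  exact (mul_eq_zero.1 hdφ).resolve_left hd

variable [IsNoetherianRing S] [IsIntegrallyClosed S]

/-- Otherwise `c / b` would map `P` into itself, hence would be integral. -/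
theorem exists_mul_eq_mul_notMem {P : Ideal S} [P.IsPrime] {b c : S} (hb : b ≠ 0)
    (hP : ∀ x, x ∈ P ↔ b ∣ x * c) : ∃ x ∈ P, ∃ y ∉ P, x * c = b * y := by
  by_contra! hstable
  let K := FractionRing S
  have hbK : algebraMap S K b ≠ 0 := by simpa using hb
  have hint : IsIntegral S (algebraMap S K c / algebraMap S K b) := by
    refine isIntegral_of_smul_mem_submodule (M := K)
      (N := Submodule.map (Algebra.linearMap S K) P) ?_ ((IsNoetherian.noetherian P).map _) _ ?_
    · exact (Submodule.ne_bot_iff _).2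
        ⟨algebraMap S K b, ⟨b, (hP b).2 (dvd_mul_right b c), rfl⟩, hbK⟩
    · rintro _ ⟨x, hx, rfl⟩
      obtain ⟨y, hy⟩ := (hP x).1 hx
      refine ⟨y, not_imp_not.1 (hstable x hx y) hy, ?_⟩
      have hyK := congrArg (algebraMap S K) hy
      rw [map_mul, map_mul] at hyK
      rw [Algebra.linearMap_apply, Algebra.linearMap_apply, smul_eq_mul, div_mul_eq_mul_div,
        eq_div_iff hbK, mul_comm, ← hyK, mul_comm]
  obtain ⟨z, hz⟩ := IsIntegrallyClosed.isIntegral_iff.1 hint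
  rw [eq_div_iff hbK, ← map_mul] at hz
  refine Ideal.IsPrime.ne_top ‹_› ((Ideal.eq_top_iff_one P).2 ((hP 1).2 ⟨z, ?_⟩))
  rw [one_mul, ← IsFractionRing.injective S K hz, mul_comm]

theorem height_eq_one_of_forall_mem_iff_dvd {P : Ideal S} [P.IsPrime] {b c : S} (hb : b ≠ 0)
    (hP : ∀ x, x ∈ P ↔ b ∣ x * c) : P.height = 1 := by
  obtain ⟨x, hx, y, hy, hxy⟩ := exists_mul_eq_mul_notMem hb hP
  have hmin : P ∈ (Ideal.span {x}).minimalPrimes := by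
    refine ⟨⟨‹_›, by simpa [Ideal.span_le] using hx⟩, ?_⟩
    rintro Q ⟨hQ, hxQ⟩ hQP z hz
    obtain ⟨w, hw⟩ := (hP z).1 hz
    have hzy : z * y = x * w := mul_left_cancel₀ hb (by linear_combination (-z) * hxy + x * hw)
    have hzyQ : z * y ∈ Q := hzy ▸ Q.mul_mem_right w (hxQ (Ideal.mem_span_singleton_self x))
    exact (hQ.mem_or_mem hzyQ).resolve_right fun h => hy (hQP h)
  refine le_antisymm (Ideal.height_le_one_of_isPrincipal_of_mem_minimalPrimes _ P hmin) ?_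
  rw [Order.one_le_iff_ne_zero, Ne, Ideal.height_eq_zero_iff_eq_bot]
  rintro rfl
  exact hb ((hP b).2 (dvd_mul_right b c))

theorem dvd_of_forall_mem_dvd_mul {D : Ideal S} (hD : 2 ≤ D.height) {a b : S} (hb : b ≠ 0)
    (h : ∀ d ∈ D, b ∣ d * a) : b ∣ a := by
  by_contra hab
  have hne : Ideal.Quotient.mk (Ideal.span {b}) a ≠ 0 := by
    rwa [Ne, Ideal.Quotient.eq_zero_iff_mem, Ideal.mem_span_singleton]
  obtain ⟨P, hPa, hle⟩ := exists_le_isAssociatedPrime_of_isNoetherianRing S _ hne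
  obtain ⟨hPp, y, hPy⟩ := isAssociatedPrime_iff.1 hPa
  obtain ⟨c, rfl⟩ := Ideal.Quotient.mk_surjective y
  have mem_colon (x z : S) :
      x ∈ (⊥ : Submodule S (S ⧸ Ideal.span {b})).colon {Ideal.Quotient.mk _ z} ↔ b ∣ x * z := by
    rw [Submodule.mem_colon_singleton, Submodule.mem_bot, ← Ideal.mem_span_singleton,
      ← Ideal.Quotient.eq_zero_iff_mem]
    rfl
  have hP1 : P.height = 1 :=
    height_eq_one_of_forall_mem_iff_dvd hb fun x => by rw [hPy, mem_colon]
  have hDP : D ≤ P := fun d hd => hle ((mem_colon d a).2 (h d hd))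
  exact absurd (hD.trans (hP1 ▸ Ideal.height_mono hDP)) (by decide)

variable {A B : Type*} [AddCommGroup A] [Module S A] [AddCommGroup B] [Module S B]

/-- A functional `f` on `A` extends to `b ↦ f a / d`, where `i a = d • b`. -/
theorem dualMap_surjective_of_two_le_height {D : Ideal S} (hD : 2 ≤ D.height) (i : A →ₗ[S] B)
    (hker : ∀ d ∈ D, ∀ a, i a = 0 → d • a = 0)
    (hrange : ∀ d ∈ D, ∀ b, d • b ∈ LinearMap.range i) : Function.Surjective i.dualMap := by
  obtain ⟨d, hdD, hd⟩ := Submodule.exists_mem_ne_zero_of_ne_bot (ne_bot_of_two_le_height hD)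
  intro f
  have hf (a a' : A) (h : i a = i a') : f a = f a' := by
    have h0 : d • (a - a') = 0 := hker d hdD _ (by rw [map_sub, h, sub_self])
    have h1 : d * f (a - a') = 0 := by rw [← smul_eq_mul, ← map_smul, h0, map_zero]
    exact sub_eq_zero.1 (map_sub f a a' ▸ (mul_eq_zero.1 h1).resolve_left hd)
  choose j hj using hrange d hdD
  have hdvd (b : B) : d ∣ f (j b) := by
    refine dvd_of_forall_mem_dvd_mul hD hd fun e he => ?_
    obtain ⟨a, ha⟩ := hrange e he b
    refine ⟨f a, ?_⟩
    rw [← smul_eq_mul, ← smul_eq_mul, ← map_smul, ← map_smul]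
    exact hf _ _ (by rw [map_smul, map_smul, hj, ha, smul_comm])
  choose F hF using hdvd
  have eq_F {a : A} {b : B} (h : i a = d • b) : f a = d * F b := by
    rw [← hF]
    exact hf _ _ (by rw [h, hj])
  refine ⟨⟨⟨F, fun b b' => mul_left_cancel₀ hd ?_⟩, fun s b => mul_left_cancel₀ hd ?_⟩, ?_⟩
  · rw [mul_add, ← hF b, ← hF b', ← map_add]
    exact (eq_F (by rw [map_add, hj, hj, smul_add])).symm
  · rw [RingHom.id_apply, smul_eq_mul, mul_left_comm, ← hF b, ← smul_eq_mul s, ← map_smul]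
    exact (eq_F (by rw [map_smul, hj, smul_comm])).symm
  · ext a
    exact mul_left_cancel₀ hd ((eq_F (map_smul i d a)).symm.trans (map_smul f d a))

theorem dualMap_bijective_of_two_le_height {D : Ideal S} (hD : 2 ≤ D.height) (i : A →ₗ[S] B)
    (hker : ∀ d ∈ D, ∀ a, i a = 0 → d • a = 0)
    (hrange : ∀ d ∈ D, ∀ b, d • b ∈ LinearMap.range i) : Function.Bijective i.dualMap := by
  obtain ⟨d, hdD, hd⟩ := Submodule.exists_mem_ne_zero_of_ne_bot (ne_bot_of_two_le_height hD)
  exact ⟨dualMap_injective_of_smul_mem_range hd i (hrange d hdD),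
    dualMap_surjective_of_two_le_height hD i hker hrange⟩

end Hartogs

/-! ### Reflexivity of duals -/

section DualReflexive

variable {S : Type*} [CommRing S] [IsDomain S] {A : Type*} [AddCommGroup A] [Module S A]

theorem exists_free_submodule_smul_mem [Module.Finite S A] :
    ∃ F : Submodule S A, Module.Free S F ∧ Module.Finite S F ∧ ∃ c : S, c ≠ 0 ∧ ∀ x, c • x ∈ F := by
  obtain ⟨n, v, hv⟩ := Module.Finite.exists_fin (R := S) (M := A)
  obtain ⟨s, hs, hmax⟩ := exists_maximal_linearIndepOn S v
  let b := Module.Basis.span (v := fun t : s => v t) hs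
  have hdep (t : Fin n) : ∃ a : S, a ≠ 0 ∧ a • v t ∈ Submodule.span S (v '' s) := by
    by_cases ht : t ∈ s
    · exact ⟨1, one_ne_zero, by simpa using Submodule.subset_span (Set.mem_image_of_mem v ht)⟩
    · exact hmax t ht
  choose a ha hav using hdep
  refine ⟨_, Module.Free.of_basis b, Module.Finite.of_basis b, ∏ t, a t,
    Finset.prod_ne_zero_iff.2 fun t _ => ha t, fun x => ?_⟩
  rw [← Set.image_eq_range]
  have hx : x ∈ Submodule.span S (Set.range v) := hv ▸ Submodule.mem_top
  induction hx using Submodule.span_induction with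
  | mem x hx =>
    obtain ⟨t, rfl⟩ := hx
    rw [← Finset.mul_prod_erase _ _ (Finset.mem_univ t), mul_comm, mul_smul]
    exact Submodule.smul_mem _ _ (hav t)
  | zero => simp
  | add x y _ _ hx hy => rw [smul_add]; exact add_mem hx hy
  | smul r x _ hx => rw [smul_comm]; exact Submodule.smul_mem _ _ hx

theorem isReflexive_dual_of_smul_mem (F : Submodule S A) [Module.IsReflexive S F] {c : S}
    (hc : c ≠ 0) (hF : ∀ x, c • x ∈ F) : Module.IsReflexive S (Module.Dual S A) := by
  let j : A →ₗ[S] F := (c • LinearMap.id).codRestrict F hF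
  have eq_zero_of_apply_eval (Φ : Module.Dual S (Module.Dual S (Module.Dual S A)))
      (hΦ : ∀ a, Φ (Module.Dual.eval S A a) = 0) : Φ = 0 := by
    have hFΦ (ξ : Module.Dual S (Module.Dual S F)) : Φ (F.subtype.dualMap.dualMap ξ) = 0 := by
      obtain ⟨y, rfl⟩ := (Module.bijective_dual_eval S F).2 ξ
      exact hΦ y
    ext ψ
    have hcψ : F.subtype.dualMap.dualMap (j.dualMap.dualMap ψ) = c • ψ := by
      ext φ
      have hφ : (φ ∘ₗ F.subtype) ∘ₗ j = c • φ := LinearMap.ext fun a => map_smul φ c a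
      exact (congrArg ψ hφ).trans (map_smul ψ c φ)
    have hcΦ := hFΦ (j.dualMap.dualMap ψ)
    rw [hcψ, map_smul, smul_eq_mul] at hcΦ
    exact (mul_eq_zero.1 hcΦ).resolve_left hc
  refine ⟨⟨fun φ φ' h => ?_, fun Φ => ⟨Φ ∘ₗ Module.Dual.eval S A, ?_⟩⟩⟩
  · ext a
    exact LinearMap.congr_fun h (Module.Dual.eval S A a)
  · exact sub_eq_zero.1 (eq_zero_of_apply_eval _ fun a => sub_self _)

theorem isReflexive_dual [Module.Finite S A] : Module.IsReflexive S (Module.Dual S A) := by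
  obtain ⟨F, _, _, c, hc, hF⟩ := exists_free_submodule_smul_mem (S := S) (A := A)
  exact isReflexive_dual_of_smul_mem F hc hF

end DualReflexive

/-! ### Finiteness and the Eakin–Nagata theorem -/

section Finiteness

theorem finite_of_isIntegral_of_essFiniteType (A B : Type*) [CommRing A] [CommRing B] [Algebra A B]
    [Algebra.IsIntegral A B] [h : Algebra.EssFiniteType A B] : Module.Finite A B := by
  obtain ⟨σ, hσ⟩ := (Algebra.essFiniteType_iff A B).1 h
  let A' := Algebra.adjoin A (σ : Set B)
  have hint : Algebra.IsIntegral A' B := Algebra.IsIntegral.tower_top A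
  have htop : A' = ⊤ := by
    refine eq_top_iff.2 fun s _ => ?_
    obtain ⟨t, ht, htu, hst⟩ := hσ s
    have hu : IsUnit (⟨t, ht⟩ : A') := isUnit_of_map_unit (algebraMap A' B) _ htu
    obtain ⟨w, hw⟩ := hu.exists_right_inv
    have hw' : t * (w : B) = 1 := congrArg Subtype.val hw
    simpa only [mul_assoc, hw', mul_one] using mul_mem hst w.2
  have : Algebra.FiniteType A B := ⟨⟨σ, htop⟩⟩
  exact Algebra.IsIntegral.finite

section EakinNagata

variable {A M : Type*} [CommRing A] [AddCommGroup M] [Module A M]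

theorem isNoetherian_quotient_annihilator [IsNoetherian A M] :
    IsNoetherian A (A ⧸ Module.annihilator A M) := by
  obtain ⟨n, v, hv⟩ := Module.Finite.exists_fin (R := A) (M := M)
  let φ : A →ₗ[A] (Fin n → M) := LinearMap.pi fun i => LinearMap.toSpanSingleton A M (v i)
  have hφ : LinearMap.ker φ = Module.annihilator A M := by
    ext a
    rw [← Submodule.annihilator_top, ← hv, Submodule.mem_annihilator_span, LinearMap.mem_ker,
      funext_iff, Set.forall_subtype_range_iff]
    rfl
  rw [← hφ]
  exact isNoetherian_of_linearEquiv φ.quotKerEquivRange.symm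

theorem isNoetherian_of_annihilator_le {N : Type*} [AddCommGroup N] [Module A N]
    [IsNoetherian A N] [Module.Finite A M]
    (h : Module.annihilator A N ≤ Module.annihilator A M) : IsNoetherian A M := by
  have := isNoetherian_quotient_annihilator (A := A) (M := N)
  obtain ⟨n, v, hv⟩ := Module.Finite.exists_fin (R := A) (M := M)
  have hcyclic (x : M) : IsNoetherian A (Submodule.span A {x}) := by
    have hx : Module.annihilator A N ≤ LinearMap.ker (LinearMap.toSpanSingleton A M x) :=
      fun a ha => Module.mem_annihilator.1 (h ha) x
    rw [← LinearMap.range_toSpanSingleton, ← Submodule.range_liftQ _ _ hx]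
    infer_instance
  rw [← isNoetherian_top_iff, ← hv, Submodule.span_range_eq_iSup]
  infer_instance

theorem mem_annihilator_quotient_iff {N : Submodule A M} {a : A} :
    a ∈ Module.annihilator A (M ⧸ N) ↔ LinearMap.range (LinearMap.lsmul A M a) ≤ N := by
  rw [Submodule.annihilator_quotient, Submodule.mem_colon, LinearMap.range_le_iff_comap,
    Submodule.eq_top_iff']
  simp

theorem fg_range_lsmul [Module.Finite A M] (a : A) :
    (LinearMap.range (LinearMap.lsmul A M a)).FG := by
  rw [LinearMap.range_eq_map]
  exact Module.Finite.fg_top.map _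

theorem range_lsmul_eq_span_smul_top (a : A) :
    LinearMap.range (LinearMap.lsmul A M a) = Ideal.span {a} • ⊤ := by
  rw [Submodule.ideal_span_singleton_smul, LinearMap.range_eq_map]
  rfl

theorem exists_maximal_annihilator_quotient_le [Module.Finite A M] :
    ∃ N : Submodule A M,
      Maximal (fun N => Module.annihilator A (M ⧸ N) ≤ Module.annihilator A M) N := by
  have sSup_mem (c : Set (Submodule A M))
      (hc : ∀ N ∈ c, Module.annihilator A (M ⧸ N) ≤ Module.annihilator A M)
      (hchain : IsChain (· ≤ ·) c) (hne : c.Nonempty) :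
      Module.annihilator A (M ⧸ sSup c) ≤ Module.annihilator A M := fun a ha => by
    obtain ⟨N, hN, haN⟩ := (CompleteLattice.isCompactElement_iff_le_of_directed_sSup_le _ _).1
      ((Submodule.fg_iff_compact _).1 (fg_range_lsmul a)) c hne hchain.directedOn
      (mem_annihilator_quotient_iff.1 ha)
    exact hc N hN (mem_annihilator_quotient_iff.2 haN)
  have hbot : Module.annihilator A (M ⧸ (⊥ : Submodule A M)) ≤ Module.annihilator A M :=
    (Submodule.quotEquivOfEqBot (⊥ : Submodule A M) rfl).annihilator_eq.le
  obtain ⟨N, -, hN⟩ := zorn_le_nonempty₀ _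
    (fun c hc hchain N hN => ⟨sSup c, sSup_mem c hc hchain ⟨N, hN⟩, fun _ => le_sSup⟩) ⊥ hbot
  exact ⟨N, hN⟩

/-- If `M ⧸ N` has the same annihilator as `M` and `N` is maximal as such, then every larger
submodule contains some `a M ≠ 0`; so `M ⧸ N` is Noetherian, hence so is `M`. -/
theorem isNoetherian_of_isNoetherian_quotient_range_lsmul [Module.Finite A M]
    (h : ∀ a ∉ Module.annihilator A M,
      IsNoetherian A (M ⧸ LinearMap.range (LinearMap.lsmul A M a))) : IsNoetherian A M := by
  obtain ⟨N, hN⟩ := exists_maximal_annihilator_quotient_le (A := A) (M := M)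
  have fg_of_lt (P : Submodule A M) (hNP : N < P) : P.FG := by
    obtain ⟨a, haP, ha⟩ := SetLike.not_le_iff_exists.1 (hN.not_prop_of_gt hNP)
    rw [mem_annihilator_quotient_iff] at haP
    have := h a ha
    refine Submodule.fg_of_fg_map_of_fg_inf_ker (LinearMap.range (LinearMap.lsmul A M a)).mkQ
      (IsNoetherian.noetherian _) ?_
    rw [Submodule.ker_mkQ, inf_eq_right.2 haP]
    exact fg_range_lsmul a
  have : IsNoetherian A (M ⧸ N) := by
    refine ⟨fun P => ?_⟩
    rcases eq_or_ne P ⊥ with rfl | hP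
    · exact Submodule.fg_bot
    · have hlt : N < P.comap N.mkQ := by
        refine lt_of_le_of_ne (N.le_comap_mkQ P) fun hNP => hP ?_
        rw [← Submodule.map_comap_eq_of_surjective N.mkQ_surjective P, ← hNP, N.mkQ_map_self]
      rw [← Submodule.map_comap_eq_of_surjective N.mkQ_surjective P]
      exact (fg_of_lt _ hlt).map _
  exact isNoetherian_of_annihilator_le hN.prop

/-- Formanek's form of the Eakin–Nagata theorem. -/
theorem isNoetherian_of_wellFoundedGT_smul_top [Module.Finite A M]
    [WellFoundedGT (Set.range fun I : Ideal A => (I • ⊤ : Submodule A M))] :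
    IsNoetherian A M := by
  have isNoetherian_quotient (K : Set.range fun I : Ideal A => (I • ⊤ : Submodule A M)) :
      IsNoetherian A (M ⧸ (K : Submodule A M)) := by
    induction K using WellFoundedGT.induction with
    | ind K ih =>
    obtain ⟨K, I, rfl⟩ := K
    refine isNoetherian_of_isNoetherian_quotient_range_lsmul fun a ha => ?_
    let K := I • (⊤ : Submodule A M)
    let L := (I ⊔ Ideal.span {a}) • (⊤ : Submodule A M)
    have hL : L = K ⊔ LinearMap.range (LinearMap.lsmul A M a) := by
      rw [range_lsmul_eq_span_smul_top, ← Submodule.sup_smul]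
    have hKL : K < L := hL ▸ left_lt_sup.2 fun h => ha (mem_annihilator_quotient_iff.2 h)
    have : IsNoetherian A (M ⧸ L) := ih ⟨L, _, rfl⟩ hKL
    let π := (LinearMap.range (LinearMap.lsmul A (M ⧸ K) a)).mkQ ∘ₗ K.mkQ
    have hLπ : L ≤ LinearMap.ker π := by
      rw [hL, LinearMap.ker_comp, Submodule.ker_mkQ]
      refine sup_le (K.le_comap_mkQ _) ?_
      rintro _ ⟨m, rfl⟩
      exact ⟨K.mkQ m, (map_smul K.mkQ a m).symm⟩
    refine isNoetherian_of_surjective (L.liftQ π hLπ) ?_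
    rw [Submodule.range_liftQ, LinearMap.range_eq_top]
    exact (Submodule.mkQ_surjective _).comp K.mkQ_surjective
  have hbot := isNoetherian_quotient ⟨⊥, ⊥, Submodule.bot_smul _⟩
  exact isNoetherian_of_linearEquiv (Submodule.quotEquivOfEqBot (⊥ : Submodule A M) rfl)

theorem isNoetherianRing_of_finite (A B : Type*) [CommRing A] [CommRing B] [Algebra A B]
    [FaithfulSMul A B] [Module.Finite A B] [IsNoetherianRing B] : IsNoetherianRing A := by
  have : WellFoundedGT (Set.range fun I : Ideal A => (I • ⊤ : Submodule A B)) := by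
    choose I hI using fun K : Set.range fun I : Ideal A => (I • ⊤ : Submodule A B) => K.2
    have hmono : StrictMono fun K => (I K).map (algebraMap A B) := fun K K' h => by
      rw [← Subtype.coe_lt_coe, ← hI K, ← hI K'] at h
      simpa only [Ideal.smul_top_eq_map, Submodule.restrictScalars_lt] using h
    exact hmono.wellFoundedGT
  have : IsNoetherian A B := isNoetherian_of_wellFoundedGT_smul_top
  exact isNoetherian_of_injective (Algebra.linearMap A B) (FaithfulSMul.algebraMap_injective A B)

end EakinNagata

end Finiteness

/-! ### Inertia and the homological different -/

section Inertia

variable {A B : Type*} [CommRing A] [CommRing B] [Algebra A B]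

theorem isUnramifiedAt_of_isUnramifiedLocalHom [Algebra.EssFiniteType A B] {p : Ideal B}
    [p.IsPrime]
    (h : IsUnramifiedLocalHom (Localization.localRingHom (p.comap (algebraMap A B)) p
      (algebraMap A B) rfl)) :
    Algebra.IsUnramifiedAt A p := by
  let A' := Localization.AtPrime (p.comap (algebraMap A B))
  let B' := Localization.AtPrime p
  let f : A' →+* B' := Localization.localRingHom _ p (algebraMap A B) rfl
  let : Algebra A' B' := f.toAlgebra
  have : IsScalarTower A A' B' := IsScalarTower.of_algebraMap_eq fun a =>
    (Localization.localRingHom_to_map _ p _ rfl a).symm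
  have : IsLocalHom (algebraMap A' B') := inferInstanceAs (IsLocalHom f)
  have : Algebra.EssFiniteType A B' := .comp A B B'
  have : Algebra.EssFiniteType A' B' := .of_comp A A' B'
  have : Algebra.IsSeparable (IsLocalRing.ResidueField A') (IsLocalRing.ResidueField B') := by
    convert! h.2 using 1
    exact Algebra.algebra_ext _ _ fun x => by
      obtain ⟨a, rfl⟩ := IsLocalRing.residue_surjective x
      rfl
  have : Algebra.FormallyUnramified A' B' := .of_map_maximalIdeal h.1
  have : Algebra.FormallyUnramified A A' := .of_isLocalization (p.comap (algebraMap A B)).primeCompl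
  exact Algebra.FormallyUnramified.comp A A' B'

variable {G : Type*} [Group G] [MulSemiringAction G B] [SMulCommClass G A B]

/-- An element of the inertia group induces an endomorphism of `B_p` that is the identity modulo
the maximal ideal, hence modulo all its powers. -/
theorem inertia_eq_bot_of_isUnramifiedAt [IsDomain B] [IsNoetherianRing B] [FaithfulSMul G B]
    (p : Ideal B) [p.IsPrime] [Algebra.IsUnramifiedAt A p] : p.inertia G = ⊥ := by
  let B' := Localization.AtPrime p
  refine (Subgroup.eq_bot_iff_forall _).2 fun g hg => ?_
  let φ : B →ₐ[A] B' := (IsScalarTower.toAlgHom A B B').comp (MulSemiringAction.toAlgHom A B g)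
  have hφ (t : p.primeCompl) : IsUnit (φ t) := by
    refine IsLocalization.map_units B' (⟨g • (t : B), fun ht => t.2 ?_⟩ : p.primeCompl)
    simpa using p.sub_mem ht (hg t)
  let ψ : B' →ₐ[A] B' := IsLocalization.liftAlgHom (M := p.primeCompl) hφ
  have hψ (b : B) : ψ (algebraMap B B' b) = algebraMap B B' (g • b) := IsLocalization.lift_eq hφ b
  have hψ_id : ψ = AlgHom.id A B' := by
    refine Algebra.FormallyUnramified.ext_of_iInf (I := IsLocalRing.maximalIdeal B')
      (Ideal.iInf_pow_eq_bot_of_isLocalRing _ (Ideal.IsPrime.ne_top inferInstance)) ?_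
    refine RingHom.congr_fun (IsLocalization.ringHom_ext p.primeCompl
      (j := (Ideal.Quotient.mk _).comp ψ.toRingHom) (k := Ideal.Quotient.mk _) ?_)
    ext b
    refine (congrArg _ (hψ b)).trans (Ideal.Quotient.eq.2 ?_)
    rw [← map_sub, IsLocalization.AtPrime.to_map_mem_maximal_iff B' p]
    exact hg b
  refine eq_of_smul_eq_smul (α := B) fun b => ?_
  rw [one_smul]
  refine IsLocalization.injective B' p.primeCompl_le_nonZeroDivisors ?_
  rw [← hψ, hψ_id]
  rfl

end Inertia

section Different

open TensorProduct

variable (A B : Type*) [CommRing A] [CommRing B] [Algebra A B]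
  {G : Type*} [Group G] [MulSemiringAction G B] [SMulCommClass G A B]

/-- The multiplication of `B` twisted by `g`, i.e. `B ⊗_A B → B`, `s ⊗ t ↦ s g(t)`, as a
homomorphism of algebras over the left factor. -/
def twistedMul (g : G) : B ⊗[A] B →ₐ[B] B :=
  Algebra.TensorProduct.lift (AlgHom.id B B) (MulSemiringAction.toAlgHom A B g)
    fun _ _ => .all _ _

variable {B} in
@[simp]
theorem twistedMul_tmul (g : G) (s t : B) : twistedMul A B g (s ⊗ₜ t) = s * g • t :=
  Algebra.TensorProduct.lift_tmul _ _ _ s t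

variable (G)

/-- The homological different of `B` over `A` relative to `G`: the image under multiplication of
the elements of `B ⊗_A B` that vanish under every nontrivial twisted multiplication. A prime
with trivial inertia does not contain it. -/
def homDifferent : Ideal B :=
  (⨅ g : {g : G // g ≠ 1}, RingHom.ker (twistedMul A B g.1)).map (twistedMul A B (1 : G))

variable {B}

theorem mem_homDifferent {d : B} : d ∈ homDifferent A B G ↔
    ∃ x, (∀ g : G, g ≠ 1 → twistedMul A B g x = 0) ∧ twistedMul A B (1 : G) x = d := by
  rw [homDifferent, Ideal.mem_map_iff_of_surjective _ fun s => ⟨s ⊗ₜ 1, by simp⟩]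
  simp [RingHom.mem_ker]

theorem not_homDifferent_le_of_inertia_eq_bot [Finite G] {p : Ideal B} [p.IsPrime]
    (hp : p.inertia G = ⊥) : ¬ homDifferent A B G ≤ p := by
  classical
  cases nonempty_fintype G
  have exists_smul_sub_notMem (h : G) : ∃ a : B, h ≠ 1 → h • a - a ∉ p := by
    by_contra! hh
    exact (hh 0).1 ((Subgroup.mem_bot).1 (hp ▸ fun a => (hh a).2))
  choose a ha using exists_smul_sub_notMem
  let x : B ⊗[A] B := ∏ h ∈ Finset.univ.erase (1 : G), ((h • a h) ⊗ₜ 1 - 1 ⊗ₜ (a h))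
  have twistedMul_x (g : G) :
      twistedMul A B g x = ∏ h ∈ Finset.univ.erase (1 : G), (h • a h - g • a h) := by
    simp [x, map_prod]
  have hx (g : G) (hg : g ≠ 1) : twistedMul A B g x = 0 := by
    rw [twistedMul_x]
    exact Finset.prod_eq_zero (Finset.mem_erase.2 ⟨hg, Finset.mem_univ g⟩) (sub_self _)
  intro hle
  have hxp : twistedMul A B (1 : G) x ∈ p := hle ((mem_homDifferent A G).2 ⟨x, hx, rfl⟩)
  rw [twistedMul_x] at hxp
  obtain ⟨h, hh, hhp⟩ := Ideal.IsPrime.prod_mem_iff.1 hxp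
  rw [one_smul] at hhp
  exact ha h (Finset.ne_of_mem_erase hh) hhp

theorem homDifferent_ne_bot [IsDomain B] [Finite G] [FaithfulSMul G B] :
    homDifferent A B G ≠ ⊥ := by
  have hinertia : (⊥ : Ideal B).inertia G = ⊥ := by
    refine (Subgroup.eq_bot_iff_forall _).2 fun g hg => eq_of_smul_eq_smul (α := B) fun b => ?_
    rw [one_smul]
    exact sub_eq_zero.1 (hg b)
  exact fun h => not_homDifferent_le_of_inertia_eq_bot A G hinertia h.le

theorem two_le_height_homDifferent [IsDomain B] [IsNoetherianRing B] [Finite G] [FaithfulSMul G B]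
    (hunr : UnramifiedInCodimOne A B) : 2 ≤ (homDifferent A B G).height := by
  have := hunr.1
  refine two_le_height (homDifferent_ne_bot A G) fun p _ hp => ?_
  have := isUnramifiedAt_of_isUnramifiedLocalHom (hunr.2 p hp)
  exact not_homDifferent_le_of_inertia_eq_bot A G (inertia_eq_bot_of_isUnramifiedAt (A := A) p)

end Different

/-! ### Modules over the skew group ring -/

section SkewModules

variable {S : Type u} [CommRing S] {G : Type u} [Group G] [MulSemiringAction G S]

theorem single_smul (M : ModuleCat.{u} (SkewMonoidAlgebra S G)) (g : G) (s : S) (m : M) :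
    SkewMonoidAlgebra.single g s • m = s • act M g m := by
  rw [act_apply, smul_def, ← mul_smul, SkewMonoidAlgebra.single_mul_single, one_mul, one_smul,
    mul_one]

instance isScalarTower_base (M : ModuleCat.{u} (SkewMonoidAlgebra S G)) :
    IsScalarTower S (SkewMonoidAlgebra S G) M where
  smul_assoc s a m := by
    induction a using SkewMonoidAlgebra.induction_on with
    | zero => simp only [smul_zero, zero_smul]
    | single g t => rw [SkewMonoidAlgebra.smul_single, single_smul, single_smul, smul_assoc]
    | add a b ha hb => rw [smul_add, add_smul, ha, hb, add_smul, smul_add]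

theorem finite_base [Finite G] (M : ModuleCat.{u} (SkewMonoidAlgebra S G))
    [Module.Finite (SkewMonoidAlgebra S G) M] : Module.Finite S M :=
  have : Module.Finite S (SkewMonoidAlgebra S G) := .of_basis SkewMonoidAlgebra.basisSingleOne
  .trans (SkewMonoidAlgebra S G) M

theorem finite_skew (M : ModuleCat.{u} (SkewMonoidAlgebra S G)) [Module.Finite S M] :
    Module.Finite (SkewMonoidAlgebra S G) M :=
  .of_restrictScalars_finite S (SkewMonoidAlgebra S G) M

/-- An `S`-linear map between `S * G`-modules that commutes with `G`, as a morphism. -/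
def homOfCommutes {M N : ModuleCat.{u} (SkewMonoidAlgebra S G)} (f : M →ₗ[S] N)
    (hf : ∀ g m, f (act M g m) = act N g (f m)) : M ⟶ N :=
  ModuleCat.ofHom
    { toFun := f
      map_add' := f.map_add
      map_smul' := fun a m => by
        induction a using SkewMonoidAlgebra.induction_on with
        | zero => simp
        | single g s => rw [single_smul, map_smul, hf, RingHom.id_apply, single_smul]
        | add a b ha hb => rw [add_smul, map_add, ha, hb, RingHom.id_apply, RingHom.id_apply,
            RingHom.id_apply, add_smul] }

section OfAction

variable {A : Type u} [AddCommGroup A] [Module S A] (ρ : G →* AddMonoid.End A)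
  (h : ∀ (g : G) (s : S) (a : A), ρ g (s • a) = (g • s) • ρ g a)

/-- The identity of `A`, as an `S`-linear equivalence onto the `S * G`-module `ofAction A ρ h`. -/
def ofActionEquiv : A ≃ₗ[S] (ofAction A ρ h : ModuleCat.{u} (SkewMonoidAlgebra S G)) where
  toFun a := a
  invFun a := a
  left_inv _ := rfl
  right_inv _ := rfl
  map_add' _ _ := rfl
  map_smul' s a := by
    refine Eq.symm ((single_smul_ofAction A ρ h 1 s a).trans ?_)
    rw [map_one]
    rfl

theorem act_ofActionEquiv (g : G) (a : A) :
    act (ofAction A ρ h) g (ofActionEquiv ρ h a) = ofActionEquiv ρ h (ρ g a) :=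
  (single_smul_ofAction A ρ h g 1 a).trans (one_smul S _)

end OfAction

end SkewModules

/-! ### The multiplication map `S ⊗_R M^G → M` -/

section Invariants

open TensorProduct

variable (k : Type v) [CommRing k] {S : Type u} [CommRing S] [Algebra k S]
  {G : Type u} [Group G] [MulSemiringAction G S] [SMulCommClass G k S]

theorem finite_invRing [Finite G] [Algebra.EssFiniteType (InvRing k S G) S] :
    Module.Finite (InvRing k S G) S := by
  have : Algebra.IsInvariant (InvRing k S G) S G := ⟨fun s hs => ⟨⟨s, hs⟩, rfl⟩⟩
  have := Algebra.IsInvariant.isIntegral (InvRing k S G) S G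
  exact finite_of_isIntegral_of_essFiniteType _ _

variable (M : ModuleCat.{u} (SkewMonoidAlgebra S G))

theorem finite_invariants [Finite G] [IsNoetherianRing S]
    [Algebra.EssFiniteType (InvRing k S G) S] [Module.Finite (SkewMonoidAlgebra S G) M] :
    Module.Finite (InvRing k S G) (invariants k S G M) := by
  have := finite_invRing k (S := S) (G := G)
  have := isNoetherianRing_of_finite (InvRing k S G) S
  have := finite_base M
  have : Module.Finite (InvRing k S G) M := .trans S M
  infer_instance

theorem act_smul_invariants (g : G) (s : S) (m : invariants k S G M) :
    act M g (s • (m : M)) = (g • s) • (m : M) := by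
  rw [act_smul, m.2 g]

/-- The `S`-linear map `S ⊗_R M^G → M`, `s ⊗ m ↦ s m`. -/
def invMul : S ⊗[InvRing k S G] (invariants k S G M) →ₗ[S] M :=
  LinearMap.liftBaseChange S (invariants k S G M).subtype

@[simp]
theorem invMul_tmul (s : S) (m : invariants k S G M) : invMul k M (s ⊗ₜ m) = s • (m : M) := rfl

theorem invMul_rTensor_actS (g : G) (x : S ⊗[InvRing k S G] (invariants k S G M)) :
    invMul k M ((actS k S G g).rTensor (invariants k S G M) x) = act M g (invMul k M x) := by
  induction x with
  | zero => simp
  | tmul s m => exact (act_smul_invariants k M g s m).symm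
  | add x y hx hy => rw [map_add, map_add, hx, hy, map_add, map_add]

section Transfer

variable [Fintype G]

/-- The trace `M → M^G`, `m ↦ ∑ g(m)`. -/
def trace : M →ₗ[InvRing k S G] invariants k S G M where
  toFun m := ⟨∑ g : G, act M g m, fun h => by
    rw [map_sum]
    refine Fintype.sum_equiv (Equiv.mulLeft h) _ _ fun g => ?_
    rw [Equiv.coe_mulLeft, map_mul]
    rfl⟩
  map_add' m n := by
    ext
    simp [Finset.sum_add_distrib]
  map_smul' r m := by
    ext
    change ∑ g : G, act M g ((r : S) • m) = (r : S) • ∑ g : G, act M g m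
    rw [Finset.smul_sum]
    refine Finset.sum_congr rfl fun g _ => ?_
    rw [act_smul, r.2 g]

theorem coe_trace (m : M) : (trace k M m : M) = ∑ g : G, act M g m := rfl

theorem tmul_trace_smul (u s : S) (m : invariants k S G M) :
    u ⊗ₜ[InvRing k S G] trace k M (s • (m : M)) = ∑ g : G, (u * g • s) ⊗ₜ m := by
  let r : InvRing k S G := ⟨∑ g : G, g • s, fun h => by
    rw [Finset.smul_sum]
    refine Fintype.sum_equiv (Equiv.mulLeft h) _ _ fun g => ?_
    rw [Equiv.coe_mulLeft, mul_smul]⟩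
  have htrace : trace k M (s • (m : M)) = r • m := by
    ext
    rw [coe_trace]
    exact (Finset.sum_congr rfl fun g _ => act_smul_invariants k M g s m).trans
      Finset.sum_smul.symm
  have hru : r • u = ∑ g : G, u * g • s := by
    rw [← Finset.mul_sum, mul_comm]
    rfl
  rw [htrace, ← smul_tmul, hru, sum_tmul]

/-- The pairing of `S ⊗_R S` and `M` with values in `S ⊗_R M^G`, `(u ⊗ t, m) ↦ u ⊗ Tr(t m)`. An
element of `S ⊗_R S` that vanishes under all nontrivial twisted multiplications turns it into an
inverse of `invMul` up to a scalar. -/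
def transfer : S ⊗[InvRing k S G] S →ₗ[InvRing k S G] M →ₗ[InvRing k S G]
    S ⊗[InvRing k S G] (invariants k S G M) :=
  (LinearMap.lTensorHom S ∘ₗ
    ((Algebra.lsmul (InvRing k S G) (InvRing k S G) M).toLinearMap.compr₂ (trace k M)).flip).flip

theorem transfer_tmul (u t : S) (m : M) :
    transfer k M (u ⊗ₜ t) m = u ⊗ₜ trace k M (t • m) := rfl

theorem invMul_transfer (x : S ⊗[InvRing k S G] S) (m : M) :
    invMul k M (transfer k M x m) = ∑ g : G, twistedMul (InvRing k S G) S g x • act M g m := by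
  induction x with
  | zero => simp
  | tmul u t =>
    rw [transfer_tmul, invMul_tmul, coe_trace, Finset.smul_sum]
    refine Finset.sum_congr rfl fun g _ => ?_
    rw [act_smul, twistedMul_tmul, mul_smul]
  | add x y hx hy => simp only [map_add, LinearMap.add_apply, hx, hy, add_smul,
      Finset.sum_add_distrib]

theorem transfer_invMul (x : S ⊗[InvRing k S G] S)
    (y : S ⊗[InvRing k S G] (invariants k S G M)) :
    transfer k M x (invMul k M y) = ∑ g : G,
      twistedMul (InvRing k S G) S g x • (actS k S G g).rTensor (invariants k S G M) y := by
  induction y with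
  | zero => simp
  | add y z hy hz => simp only [map_add, hy, hz, smul_add, Finset.sum_add_distrib]
  | tmul s m =>
    induction x with
    | zero => simp
    | add x y hx hy => simp only [map_add, LinearMap.add_apply, hx, hy, add_smul,
        Finset.sum_add_distrib]
    | tmul u t =>
      rw [invMul_tmul, transfer_tmul, ← mul_smul, tmul_trace_smul]
      refine Finset.sum_congr rfl fun g _ => ?_
      rw [smul_mul', ← mul_assoc, ← twistedMul_tmul (InvRing k S G)]
      rfl

end Transfer

variable [Finite G]

theorem smul_mem_range_invMul {d : S} (hd : d ∈ homDifferent (InvRing k S G) S G) (m : M) :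
    d • m ∈ LinearMap.range (invMul k M) := by
  cases nonempty_fintype G
  obtain ⟨x, hx, rfl⟩ := (mem_homDifferent _ G).1 hd
  refine ⟨transfer k M x m, ?_⟩
  rw [invMul_transfer, Fintype.sum_eq_single 1 fun g hg => by rw [hx g hg, zero_smul], map_one]
  rfl

theorem smul_eq_zero_of_invMul_eq_zero {d : S} (hd : d ∈ homDifferent (InvRing k S G) S G)
    (y : S ⊗[InvRing k S G] (invariants k S G M)) (hy : invMul k M y = 0) : d • y = 0 := by
  cases nonempty_fintype G
  obtain ⟨x, hx, rfl⟩ := (mem_homDifferent _ G).1 hd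
  have actS_one : actS k S G 1 = LinearMap.id := LinearMap.ext (one_smul G)
  have h := transfer_invMul k M x y
  rw [hy, map_zero, Fintype.sum_eq_single 1 fun g hg => by rw [hx g hg, zero_smul], actS_one,
    LinearMap.rTensor_id] at h
  exact h.symm

theorem dualMap_invMul_bijective [IsDomain S] [IsNoetherianRing S] [IsIntegrallyClosed S]
    [FaithfulSMul G S] (hunr : UnramifiedInCodimOne (InvRing k S G) S) :
    Function.Bijective (invMul k M).dualMap :=
  dualMap_bijective_of_two_le_height (two_le_height_homDifferent _ G hunr) _
    (fun _ hd => smul_eq_zero_of_invMul_eq_zero k M hd)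
    (fun _ hd => smul_mem_range_invMul k M hd)

end Invariants

/-! ### Biduality of modules over the skew group ring -/

section Biduality

variable {S : Type u} [CommRing S] {G : Type u} [Group G] [MulSemiringAction G S]

/-- The `S * G`-module `M^*`. -/
abbrev dualObj (M : ModuleCat.{u} (SkewMonoidAlgebra S G)) :
    ModuleCat.{u} (SkewMonoidAlgebra S G) :=
  (dualFunctor S G).obj (Opposite.op M)

/-- The identity of `Hom_S(M, S)`, as an `S`-linear equivalence onto the `S * G`-module `M^*`. -/
def dualObjEquiv (M : ModuleCat.{u} (SkewMonoidAlgebra S G)) :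
    Module.Dual S M ≃ₗ[S] dualObj M :=
  ofActionEquiv (dualAct M) (dualAct_smul M)

theorem act_dualObjEquiv (M : ModuleCat.{u} (SkewMonoidAlgebra S G)) (g : G)
    (φ : Module.Dual S M) :
    act (dualObj M) g (dualObjEquiv M φ) = dualObjEquiv M (dualAct M g φ) :=
  act_ofActionEquiv _ _ g φ

theorem dualObjEquiv_symm_act (M : ModuleCat.{u} (SkewMonoidAlgebra S G)) (g : G)
    (φ : dualObj M) (m : M) :
    (dualObjEquiv M).symm (act (dualObj M) g φ) m =
      g • (dualObjEquiv M).symm φ (act M g⁻¹ m) := by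
  obtain ⟨φ, rfl⟩ := (dualObjEquiv M).surjective φ
  rw [act_dualObjEquiv, LinearEquiv.symm_apply_apply, LinearEquiv.symm_apply_apply, dualAct_apply]

theorem finite_dualObj [IsNoetherianRing S] (M : ModuleCat.{u} (SkewMonoidAlgebra S G))
    [Module.Finite S M] : Module.Finite S (dualObj M) :=
  have : Module.Finite S (Module.Dual S M) := Module.IsNoetherian.finite S _
  .equiv (dualObjEquiv M)

theorem isReflexive_dualObj [IsDomain S] (M : ModuleCat.{u} (SkewMonoidAlgebra S G))
    [Module.Finite S M] : Module.IsReflexive S (dualObj M) :=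
  have : Module.IsReflexive S (Module.Dual S M) := isReflexive_dual
  Module.equiv (dualObjEquiv M)

theorem isIso_dualFunctor_map {M N : ModuleCat.{u} (SkewMonoidAlgebra S G)} (f : M ⟶ N)
    (hf : Function.Bijective (homBase f).dualMap) : IsIso ((dualFunctor S G).map f.op) :=
  (ConcreteCategory.isIso_iff_bijective _).2 hf

/-- The evaluation map `M → M^{**}` as an `S`-linear map. -/
def evalBidual (M : ModuleCat.{u} (SkewMonoidAlgebra S G)) : M →ₗ[S] dualObj (dualObj M) :=
  (dualObjEquiv (dualObj M)).toLinearMap ∘ₗ (dualObjEquiv M).symm.toLinearMap.dualMap ∘ₗ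
    Module.Dual.eval S M

theorem evalBidual_apply (M : ModuleCat.{u} (SkewMonoidAlgebra S G)) (m : M) (φ : dualObj M) :
    (dualObjEquiv (dualObj M)).symm (evalBidual M m) φ = (dualObjEquiv M).symm φ m := rfl

theorem evalBidual_act (M : ModuleCat.{u} (SkewMonoidAlgebra S G)) (g : G) (m : M) :
    evalBidual M (act M g m) = act (dualObj (dualObj M)) g (evalBidual M m) := by
  apply (dualObjEquiv (dualObj M)).symm.injective
  refine LinearMap.ext fun φ => ?_
  rw [evalBidual_apply, dualObjEquiv_symm_act, evalBidual_apply, dualObjEquiv_symm_act, inv_inv,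
    smul_inv_smul]

theorem evalBidual_bijective (M : ModuleCat.{u} (SkewMonoidAlgebra S G))
    [Module.IsReflexive S M] : Function.Bijective (evalBidual M) :=
  (dualObjEquiv (dualObj M)).bijective.comp
    ((dualObjEquiv M).symm.dualMap.bijective.comp (Module.bijective_dual_eval S M))

variable (S G)

/-- The bidual functor `M ↦ M^{**}` on `S * G`-modules. -/
abbrev bidualFunctor : ModuleCat.{u} (SkewMonoidAlgebra S G) ⥤
    ModuleCat.{u} (SkewMonoidAlgebra S G) :=
  (dualFunctor S G).rightOp ⋙ dualFunctor S G

/-- The evaluation maps `M → M^{**}` as a natural transformation. -/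
def evalBidualNat : 𝟭 (ModuleCat.{u} (SkewMonoidAlgebra S G)) ⟶ bidualFunctor S G where
  app M := homOfCommutes (evalBidual M) (evalBidual_act M)
  naturality _ _ _ := rfl

variable {S G}

theorem isIso_evalBidualNat_app (M : ModuleCat.{u} (SkewMonoidAlgebra S G))
    [Module.IsReflexive S M] : IsIso ((evalBidualNat S G).app M) :=
  (ConcreteCategory.isIso_iff_bijective _).2 (evalBidual_bijective M)

end Biduality

/-! ### Invariants and base change -/

section BaseChange

open TensorProduct

variable (k : Type v) [CommRing k] {S : Type u} [CommRing S] [Algebra k S]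
  {G : Type u} [Group G] [MulSemiringAction G S] [SMulCommClass G k S]

/-- The restriction of a homomorphism to the invariants. -/
def invariantsMap {M N : ModuleCat.{u} (SkewMonoidAlgebra S G)} (f : M ⟶ N) :
    invariants k S G M →ₗ[InvRing k S G] invariants k S G N :=
  ((invFunctor k S G).map f).hom

theorem invariantsMap_bijective {M N : ModuleCat.{u} (SkewMonoidAlgebra S G)} (f : M ⟶ N)
    [IsIso f] : Function.Bijective (invariantsMap k f) :=
  (ConcreteCategory.isIso_iff_bijective _).1 (inferInstanceAs (IsIso ((invFunctor k S G).map f)))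

/-- The identity of `S ⊗_R N`, as an `S`-linear equivalence onto the `S * G`-module `S ⊗_R N`. -/
def tensorObjEquiv (N : ModuleCat.{u} (InvRing k S G)) :
    (S ⊗[InvRing k S G] N) ≃ₗ[S] (tensorFunctor k S G).obj N :=
  ofActionEquiv (tensorAct k S G N) (tensorAct_smul k S G N)

theorem act_tensorObjEquiv (N : ModuleCat.{u} (InvRing k S G)) (g : G)
    (x : S ⊗[InvRing k S G] N) :
    act ((tensorFunctor k S G).obj N) g (tensorObjEquiv k N x) =
      tensorObjEquiv k N (tensorAct k S G N g x) :=
  act_ofActionEquiv _ _ g x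

theorem invMul_lTensor {M N : ModuleCat.{u} (SkewMonoidAlgebra S G)} (f : M ⟶ N)
    (x : S ⊗[InvRing k S G] (invariants k S G M)) :
    invMul k N ((invariantsMap k f).lTensor S x) = homBase f (invMul k M x) := by
  induction x with
  | zero => simp
  | tmul s m => exact ((homBase f).map_smul s (m : M)).symm
  | add x y hx hy => rw [map_add, map_add, hx, hy, map_add, map_add]

variable (S G) in
/-- The maps `S ⊗_R M^G → M` as a natural transformation. -/
def invMulNat : invFunctor k S G ⋙ tensorFunctor k S G ⟶
    𝟭 (ModuleCat.{u} (SkewMonoidAlgebra S G)) where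
  app M := homOfCommutes
    (invMul k M ∘ₗ (tensorObjEquiv k ((invFunctor k S G).obj M)).symm.toLinearMap)
    (fun g x => (congrArg (invMul k M ∘ (tensorObjEquiv k ((invFunctor k S G).obj M)).symm)
      (act_tensorObjEquiv k ((invFunctor k S G).obj M) g x)).trans
        (invMul_rTensor_actS k M g x))
  naturality M N f := by
    ext x
    exact invMul_lTensor k f x

theorem isIso_dualFunctor_map_invMulNat_app (M : ModuleCat.{u} (SkewMonoidAlgebra S G))
    (h : Function.Bijective (invMul k M).dualMap) :
    IsIso ((dualFunctor S G).map ((invMulNat k S G).app M).op) :=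
  isIso_dualFunctor_map _
    ((tensorObjEquiv k ((invFunctor k S G).obj M)).symm.dualMap.bijective.comp h)

/-- The `R`-linear map `N → (S ⊗_R N)^G`, `n ↦ 1 ⊗ n`. -/
def unitTensor (N : ModuleCat.{u} (InvRing k S G)) :
    N →ₗ[InvRing k S G] invariants k S G ((tensorFunctor k S G).obj N) where
  toFun n := ⟨tensorObjEquiv k N (1 ⊗ₜ n), fun g => by
    rw [act_tensorObjEquiv, tensorAct_tmul, smul_one]⟩
  map_add' m n := by
    ext
    simp [tmul_add]
  map_smul' r n := by
    ext
    change tensorObjEquiv k N (1 ⊗ₜ (r • n)) = (r : S) • tensorObjEquiv k N (1 ⊗ₜ n)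
    rw [← map_smul, ← smul_tmul, smul_tmul']
    rfl

theorem dual_tensorFunctor_obj_ext {N : ModuleCat.{u} (InvRing k S G)}
    {φ ψ : Module.Dual S ((tensorFunctor k S G).obj N)}
    (h : ∀ n, φ (unitTensor k N n : (tensorFunctor k S G).obj N) =
      ψ (unitTensor k N n : (tensorFunctor k S G).obj N)) : φ = ψ :=
  (tensorObjEquiv k N).dualMap.injective
    ((LinearMap.liftBaseChangeEquiv S).symm.injective (LinearMap.ext h))

/-- The restriction map `(M^*)^G → Hom_R(M^G, R)`. -/
def restrictDual (M : ModuleCat.{u} (SkewMonoidAlgebra S G)) :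
    invariants k S G (dualObj M) →ₗ[InvRing k S G]
      Module.Dual (InvRing k S G) (invariants k S G M) where
  toFun φ :=
    { toFun := fun m => ⟨(dualObjEquiv M).symm (φ : dualObj M) (m : M), fun g => by
        have h := dualObjEquiv_symm_act M g (φ : dualObj M) (m : M)
        rw [φ.2 g, m.2 g⁻¹] at h
        exact h.symm⟩
      map_add' := fun m n => by
        ext
        simp
      map_smul' := fun r m => by
        ext
        exact ((dualObjEquiv M).symm (φ : dualObj M)).map_smul (r : S) (m : M) }
  map_add' φ ψ := by
    ext m
    simp
  map_smul' r φ := by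
    ext m
    exact LinearMap.congr_fun ((dualObjEquiv M).symm.map_smul (r : S) (φ : dualObj M)) (m : M)

theorem dualMap_unitTensor_comp_restrictDual_bijective (N : ModuleCat.{u} (InvRing k S G)) :
    Function.Bijective ((unitTensor k N).dualMap ∘ₗ
      restrictDual k ((tensorFunctor k S G).obj N)) := by
  constructor
  · intro φ ψ h
    refine Subtype.ext ((dualObjEquiv _).symm.injective (dual_tensorFunctor_obj_ext k fun n => ?_))
    exact congrArg Subtype.val (LinearMap.congr_fun h n)
  · intro f
    let F : Module.Dual S ((tensorFunctor k S G).obj N) :=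
      LinearMap.liftBaseChange S (Algebra.linearMap (InvRing k S G) S ∘ₗ f) ∘ₗ
        (tensorObjEquiv k N).symm.toLinearMap
    have hF (n : N) : F (unitTensor k N n : (tensorFunctor k S G).obj N) = f n := one_mul _
    have hinv (g : G) : dualAct _ g F = F := dual_tensorFunctor_obj_ext k fun n => by
      rw [dualAct_apply, (unitTensor k N n).2, hF, (f n).2 g]
    refine ⟨⟨dualObjEquiv _ F, fun g => by rw [act_dualObjEquiv, hinv]⟩, ?_⟩
    ext n
    exact hF n

theorem restrictDual_bijective (M : ModuleCat.{u} (SkewMonoidAlgebra S G))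
    (h : Function.Bijective (invMul k M).dualMap) : Function.Bijective (restrictDual k M) := by
  let N := (invFunctor k S G).obj M
  have := isIso_dualFunctor_map_invMulNat_app k M h
  have hcomp : restrictDual k M =
      ((unitTensor k N).dualMap ∘ₗ restrictDual k ((tensorFunctor k S G).obj N)) ∘ₗ
        invariantsMap k ((dualFunctor S G).map ((invMulNat k S G).app M).op) := by
    ext φ m
    exact congrArg ((dualObjEquiv M).symm (φ : dualObj M)) (one_smul S (m : M)).symm
  rw [hcomp]
  exact (dualMap_unitTensor_comp_restrictDual_bijective k N).comp (invariantsMap_bijective k _)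

/-- Taking invariants commutes with duals, so `M^G → (M^G)^{**}` is the invariant part of
`M → M^{**}`. -/
theorem isReflexive_invariants (M : ModuleCat.{u} (SkewMonoidAlgebra S G))
    [Module.IsReflexive S M] (h : Function.Bijective (restrictDual k M))
    (h' : Function.Bijective (restrictDual k (dualObj M))) :
    Module.IsReflexive (InvRing k S G) (invariants k S G M) := by
  let α := LinearEquiv.ofBijective _ h
  have := isIso_evalBidualNat_app M
  have hcomp : α.dualMap ∘ Module.Dual.eval (InvRing k S G) (invariants k S G M) =
      restrictDual k (dualObj M) ∘ invariantsMap k ((evalBidualNat S G).app M) := rfl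
  refine ⟨(Function.Bijective.of_comp_iff' α.dualMap.bijective _).1 (hcomp ▸ ?_)⟩
  exact h'.comp (invariantsMap_bijective k ((evalBidualNat S G).app M))

variable (S G) in
/-- The maps `N → ((S ⊗_R N)^{**})^G` as a natural transformation. -/
def unitNat : 𝟭 (ModuleCat.{u} (InvRing k S G)) ⟶
    reflTensorFunctor k S G ⋙ invFunctor k S G where
  app N := ModuleCat.ofHom (unitTensor k N) ≫
    (invFunctor k S G).map ((evalBidualNat S G).app ((tensorFunctor k S G).obj N))
  naturality _ _ _ := rfl

/-- Under `(M^*)^G ≅ (M^G)^*` for `M = (S ⊗_R N)^*` and `((S ⊗_R N)^*)^G ≅ N^*`, the map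
`N → ((S ⊗_R N)^{**})^G` becomes the evaluation `N → N^{**}`. -/
theorem isIso_unitNat_app (N : ModuleCat.{u} (InvRing k S G))
    [Module.IsReflexive (InvRing k S G) N]
    (h : Function.Bijective (restrictDual k (dualObj ((tensorFunctor k S G).obj N)))) :
    IsIso ((unitNat k S G).app N) := by
  rw [ConcreteCategory.isIso_iff_bijective]
  let α := LinearEquiv.ofBijective _ (dualMap_unitTensor_comp_restrictDual_bijective k N)
  have hcomp : α.dualMap ∘ Module.Dual.eval (InvRing k S G) N =
      restrictDual k (dualObj ((tensorFunctor k S G).obj N)) ∘ ((unitNat k S G).app N).hom := rfl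
  refine (Function.Bijective.of_comp_iff' h _).1 (hcomp ▸ ?_)
  exact α.dualMap.bijective.comp (Module.bijective_dual_eval (InvRing k S G) N)

end BaseChange

/-! ### The equivalence -/

section Equivalence

variable (k : Type v) [CommRing k] {S : Type u} [CommRing S] [IsDomain S] [IsNoetherianRing S]
  [Algebra k S] {G : Type u} [Group G] [MulSemiringAction G S] [SMulCommClass G k S]

theorem isRefSkew_reflTensorFunctor_obj (N : ModuleCat.{u} (InvRing k S G))
    (hN : IsRef (InvRing k S G) N) : IsRefSkew S G ((reflTensorFunctor k S G).obj N) := by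
  have := hN.1
  have : Module.Finite S ((tensorFunctor k S G).obj N) := .equiv (tensorObjEquiv k N)
  have := finite_dualObj ((tensorFunctor k S G).obj N)
  have := finite_dualObj (dualObj ((tensorFunctor k S G).obj N))
  exact ⟨finite_skew (dualObj (dualObj ((tensorFunctor k S G).obj N))),
    isReflexive_dualObj (dualObj ((tensorFunctor k S G).obj N))⟩

variable (S G) in
/-- The functor `N ↦ (S ⊗_R N)^{**}` from `Ref(R)` to `Ref(S * G)`. -/
abbrev refTensorFunctor :
    (IsRef (InvRing k S G)).FullSubcategory ⥤ (IsRefSkew S G).FullSubcategory :=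
  (IsRefSkew S G).lift ((IsRef (InvRing k S G)).ι ⋙ reflTensorFunctor k S G)
    (fun N => isRefSkew_reflTensorFunctor_obj k N.obj N.property)

variable [IsIntegrallyClosed S] [Finite G] [FaithfulSMul G S]

theorem restrictDual_bijective_of_unramifiedInCodimOne
    (hunr : UnramifiedInCodimOne (InvRing k S G) S)
    (M : ModuleCat.{u} (SkewMonoidAlgebra S G)) : Function.Bijective (restrictDual k M) :=
  restrictDual_bijective k M (dualMap_invMul_bijective k M hunr)

theorem isRef_invFunctor_obj (hunr : UnramifiedInCodimOne (InvRing k S G) S)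
    (M : ModuleCat.{u} (SkewMonoidAlgebra S G)) (hM : IsRefSkew S G M) :
    IsRef (InvRing k S G) ((invFunctor k S G).obj M) :=
  have := hM.1
  have := hM.2
  have := hunr.1
  ⟨finite_invariants k M, isReflexive_invariants k M
    (restrictDual_bijective_of_unramifiedInCodimOne k hunr _)
    (restrictDual_bijective_of_unramifiedInCodimOne k hunr _)⟩

/-- The functor `M ↦ M^G` from `Ref(S * G)` to `Ref(R)`. -/
abbrev refInvFunctor (hunr : UnramifiedInCodimOne (InvRing k S G) S) :
    (IsRefSkew S G).FullSubcategory ⥤ (IsRef (InvRing k S G)).FullSubcategory :=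
  (IsRef (InvRing k S G)).lift ((IsRefSkew S G).ι ⋙ invFunctor k S G)
    (fun M => isRef_invFunctor_obj k hunr M.obj M.property)

/-- The natural isomorphism `M ≅ (S ⊗_R M^G)^{**}` on `Ref(S * G)`: the evaluation `M → M^{**}`
followed by the inverse of the bidual of `S ⊗_R M^G → M`. -/
def refUnitIso (hunr : UnramifiedInCodimOne (InvRing k S G) S) :
    𝟭 (IsRefSkew S G).FullSubcategory ≅ refInvFunctor k hunr ⋙ refTensorFunctor k S G :=
  let ev := Functor.whiskerLeft (IsRefSkew S G).ι (evalBidualNat S G)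
  let mul := Functor.whiskerLeft (IsRefSkew S G).ι
    (Functor.whiskerRight (invMulNat k S G) (bidualFunctor S G))
  have : IsIso ev := (NatTrans.isIso_iff_isIso_app ev).2 fun M =>
    have := M.property.2
    isIso_evalBidualNat_app M.obj
  have : IsIso mul := (NatTrans.isIso_iff_isIso_app mul).2 fun M =>
    have := isIso_dualFunctor_map_invMulNat_app k M.obj (dualMap_invMul_bijective k M.obj hunr)
    inferInstanceAs (IsIso ((dualFunctor S G).map
      ((dualFunctor S G).map ((invMulNat k S G).app M.obj).op).op))
  Functor.fullyFaithfulCancelRight (IsRefSkew S G).ι (asIso ev ≪≫ (asIso mul).symm)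

/-- The natural isomorphism `((S ⊗_R N)^{**})^G ≅ N` on `Ref(R)`, inverse to `n ↦ 1 ⊗ n`. -/
def refCounitIso (hunr : UnramifiedInCodimOne (InvRing k S G) S) :
    refTensorFunctor k S G ⋙ refInvFunctor k hunr ≅ 𝟭 (IsRef (InvRing k S G)).FullSubcategory :=
  let unit := Functor.whiskerLeft (IsRef (InvRing k S G)).ι (unitNat k S G)
  have : IsIso unit := (NatTrans.isIso_iff_isIso_app unit).2 fun N =>
    have := N.property.2
    isIso_unitNat_app k N.obj (restrictDual_bijective_of_unramifiedInCodimOne k hunr _)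
  Functor.fullyFaithfulCancelRight (IsRef (InvRing k S G)).ι (asIso unit).symm

/-- The equivalence of `Ref(S * G)` with `Ref(R)`. -/
def refEquivalence (hunr : UnramifiedInCodimOne (InvRing k S G) S) :
    (IsRefSkew S G).FullSubcategory ≌ (IsRef (InvRing k S G)).FullSubcategory :=
  CategoryTheory.Equivalence.mk (refInvFunctor k hunr) (refTensorFunctor k S G)
    (refUnitIso k hunr) (refCounitIso k hunr)

end Equivalence

end AuslanderRef

end

theorem theorem3p4p13_general (k : Type v) [CommRing k] {S : Type u} [CommRing S] [IsDomain S]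
    [IsNoetherianRing S] [IsIntegrallyClosed S] [Algebra k S]
    {G : Type u} [Group G] [Finite G] [MulSemiringAction G S] [SMulCommClass G k S]
    [FaithfulSMul G S]
    (hunr : AuslanderRef.UnramifiedInCodimOne (AuslanderRef.InvRing k S G) S) :
    ∃ (hInv : ∀ M, AuslanderRef.IsRefSkew S G M →
        AuslanderRef.IsRef (AuslanderRef.InvRing k S G) ((AuslanderRef.invFunctor k S G).obj M))
      (hTensor : ∀ N, AuslanderRef.IsRef (AuslanderRef.InvRing k S G) N →
        AuslanderRef.IsRefSkew S G ((AuslanderRef.reflTensorFunctor k S G).obj N))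
      (e : (AuslanderRef.IsRefSkew S G).FullSubcategory ≌
        (AuslanderRef.IsRef (AuslanderRef.InvRing k S G)).FullSubcategory),
      e.functor = (AuslanderRef.IsRef (AuslanderRef.InvRing k S G)).lift
        ((AuslanderRef.IsRefSkew S G).ι ⋙ AuslanderRef.invFunctor k S G)
        (fun M => hInv M.obj M.property) ∧
      e.inverse = (AuslanderRef.IsRefSkew S G).lift
        ((AuslanderRef.IsRef (AuslanderRef.InvRing k S G)).ι ⋙
          AuslanderRef.reflTensorFunctor k S G)
        (fun N => hTensor N.obj N.property) :=
  ⟨AuslanderRef.isRef_invFunctor_obj k hunr, AuslanderRef.isRefSkew_reflTensorFunctor_obj k,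
    AuslanderRef.refEquivalence k hunr, rfl, rfl⟩

theorem theorem3p4p13 {k : Type v} [Field k] [IsAlgClosed k]
    {S : Type u} [CommRing S] [IsDomain S] [IsLocalRing S] [IsNoetherianRing S]
    [IsIntegrallyClosed S] [Algebra k S]
    (hres : Function.Bijective (algebraMap k (IsLocalRing.ResidueField S)))
    (G : Subgroup (S ≃ₐ[k] S)) [Finite G] (hG : IsUnit (Nat.card G : k))
    (hunr : AuslanderRef.UnramifiedInCodimOne (AuslanderRef.InvRing k S G) S) :
    ∃ (hInv : ∀ M, AuslanderRef.IsRefSkew S G M →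
        AuslanderRef.IsRef (AuslanderRef.InvRing k S G) ((AuslanderRef.invFunctor k S G).obj M))
      (hTensor : ∀ N, AuslanderRef.IsRef (AuslanderRef.InvRing k S G) N →
        AuslanderRef.IsRefSkew S G ((AuslanderRef.reflTensorFunctor k S G).obj N))
      (e : (AuslanderRef.IsRefSkew S G).FullSubcategory ≌
        (AuslanderRef.IsRef (AuslanderRef.InvRing k S G)).FullSubcategory),
      e.functor = (AuslanderRef.IsRef (AuslanderRef.InvRing k S G)).lift
        ((AuslanderRef.IsRefSkew S G).ι ⋙ AuslanderRef.invFunctor k S G)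
        (fun M => hInv M.obj M.property) ∧
      e.inverse = (AuslanderRef.IsRefSkew S G).lift
        ((AuslanderRef.IsRef (AuslanderRef.InvRing k S G)).ι ⋙
          AuslanderRef.reflTensorFunctor k S G)
        (fun N => hTensor N.obj N.property) :=
  theorem3p4p13_general k hunr
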